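/- Let $Q$ be a finite-dimensional smooth manifold (without boundary), $\tau_Q:TQ\to Q$ its tangent bundle, with bundle coordinates $(q^i,\dot q^i)$, $S=\mathrm dq^i\otimes\partial/\partial\dot q^i$ the vertical endomorphism, $(S^*\alpha)(\cdot)=\alpha(S\,\cdot)$ its adjoint acting on 1-forms, and $\Delta=\dot q^i\,\partial/\partial\dot q^i$ the Liouville vector field. For a smooth vector field $X=X^i\,\partial/\partial q^i$ on $Q$ let $X^v=X^i\,\partial/\partial\dot q^i$ be its vertical lift and $X^c=X^i\,\partial/\partial q^i+\dot q^j\frac{\partial X^i}{\partial q^j}\,\partial/\partial\dot q^i$ its complete lift to $TQ$. Let $\mathcal R:TQ\to\mathbb R$ be a smooth function (not necessarily quadratic in the velocities) and let $\beta=S^*(\mathrm d\mathcal R)$. (a) For every smooth vector field $X$ on $Q$, $$\beta(X^c)=X^v(\mathcal R),\qquad \mathcal L_{X^c}\beta=S^*\bigl(\mathrm d(X^c(\mathcal R))\bigr),$$ and for every vector field $\tilde X$ on $TQ$, $$\beta(\tilde X)=(S\tilde X)(\mathcal R).$$ (b) Let $L:TQ\to\mathbb R$ be a smooth regular Lagrangian,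 i.e. the Hessian $\bigl(\partial^2L/\partial\dot q^i\partial\dot q^j\bigr)$ is invertible at every point of $TQ$. Put $\alpha_L=S^*(\mathrm dL)$, $\omega_L=-\mathrm d\alpha_L$ and $E_L=\Delta(L)-L$. Then the equation $$\iota_{\xi}\omega_L=\mathrm dE_L+\beta$$ has a unique solution $\xi=\xi_{L,\beta}$, the forced Euler–Lagrange vector field, and for every smooth vector field $X$ on $Q$, $$X^c(L)=X^v(\mathcal R)\ \text{ on } TQ\quad\Longleftrightarrow\quad X^v(L)\ \text{is a constant of the motion, i.e. } \xi_{L,\beta}\bigl(X^v(L)\bigr)=0\ \text{ on } TQ.$$ -/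

import Mathlib

open scoped Manifold ContDiff

noncomputable section

namespace ForcedLagrangian

section Forms

variable {F : Type*} [NormedAddCommGroup F] [NormedSpace ℝ F]
  {H : Type*} [TopologicalSpace H] (I : ModelWithCorners ℝ F H)
  {M : Type*} [TopologicalSpace M] [ChartedSpace H M]

/-- A vector field on `M` (smoothness is imposed separately). -/
abbrev VField (I : ModelWithCorners ℝ F H) (M : Type*) [TopologicalSpace M] [ChartedSpace H M] :=
  (p : M) → TangentSpace I p

/-- A differential 1-form on `M` (smoothness is imposed separately). -/
abbrev OneForm (I : ModelWithCorners ℝ F H) (M : Type*) [TopologicalSpace M]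
    [ChartedSpace H M] :=
  (p : M) → (TangentSpace I p →L[ℝ] ℝ)

/-- The differential `df` of a function, as a 1-form. -/
def differential (f : M → ℝ) : OneForm I M := fun p => mvfderiv I f p

/-- The function `Y(f) = df(Y)`. -/
def applyField (Y : VField I M) (f : M → ℝ) : M → ℝ := fun p => mvfderiv I f p (Y p)

/-- The function `α(Y)`. -/
def contract (α : OneForm I M) (Y : VField I M) : M → ℝ := fun p => α p (Y p)

/-- The coordinate expression of a 1-form in the preferred chart `φ` at `p`:
the pullback of `α` along `φ⁻¹`, a 1-form on (an open subset of) the model vector space. -/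
def inChart (α : OneForm I M) (p : M) (y : F) : F →L[ℝ] ℝ :=
  (α ((extChartAt I p).symm y)).comp
    (mfderiv 𝓘(ℝ, F) I (extChartAt I p).symm y :
      F →L[ℝ] TangentSpace I ((extChartAt I p).symm y))

/-- The exterior derivative `dα` of a 1-form on a manifold without boundary, evaluated at `p` on
two tangent vectors: `(dα)_p(u, w) = (d((φ⁻¹)^* α))_{φ(p)}(Tφ u, Tφ w)` with `φ` the preferred
chart at `p` and the exterior derivative on the model vector space on the right. -/
def dOneForm (α : OneForm I M) (p : M) (u w : TangentSpace I p) : ℝ :=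
  extDeriv
    (fun y : F => ContinuousAlternatingMap.ofSubsingleton ℝ F ℝ (0 : Fin 1) (inChart I α p y))
    (extChartAt I p p)
    ![(mfderiv I 𝓘(ℝ, F) (extChartAt I p) p u : F),
      (mfderiv I 𝓘(ℝ, F) (extChartAt I p) p w : F)]

/-- The Lie derivative `𝓛_Y α = ι_Y dα + d(α(Y))` of a 1-form along a vector field (Cartan), at
the point `p` on a tangent vector `w`. -/
def lieDerivOneForm (Y : VField I M) (α : OneForm I M) (p : M) (w : TangentSpace I p) : ℝ :=
  dOneForm I α p (Y p) w + mvfderiv I (contract I α Y) p w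

end Forms

section TangentBundle

variable {E : Type*} [NormedAddCommGroup E] [NormedSpace ℝ E]
  {Q : Type*} [TopologicalSpace Q] [ChartedSpace E Q] [IsManifold 𝓘(ℝ, E) ∞ Q]

/-- The tangent bundle `TQ`. -/
abbrev TB (E : Type*) [NormedAddCommGroup E] [NormedSpace ℝ E]
    (Q : Type*) [TopologicalSpace Q] [ChartedSpace E Q] := TangentBundle 𝓘(ℝ, E) Q

/-- The model of the manifold `TQ`. -/
abbrev IT (E : Type*) [NormedAddCommGroup E] [NormedSpace ℝ E] := (𝓘(ℝ, E)).tangent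

/-- The vertical lift at `v ∈ T_q Q`, `T_q Q → T_v(TQ)`: the derivative at `v` of the inclusion of
the fibre `T_q Q` (identified with the model space `E`) in `TQ`; in bundle coordinates
`w ↦ w^i ∂/∂q̇^i`. -/
def vlift (v : TB E Q) : TangentSpace 𝓘(ℝ, E) v.proj →L[ℝ] TangentSpace (IT E) v :=
  mfderiv 𝓘(ℝ, E) (IT E) (fun w : E => (⟨v.proj, w⟩ : TB E Q)) v.snd

/-- The vertical lift `X^v = X^i ∂/∂q̇^i` of a vector field `X` on `Q`. -/
def verticalLift (X : VField 𝓘(ℝ, E) Q) : VField (IT E) (TB E Q) :=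
  fun v => vlift v (X v.proj)

/-- The Liouville vector field `Δ = q̇^i ∂/∂q̇^i`. -/
def liouville : VField (IT E) (TB E Q) := fun v => vlift v v.snd

/-- The complete lift `X^c = X^i ∂/∂q^i + q̇^j (∂X^i/∂q^j) ∂/∂q̇^i` of a vector field `X` on `Q`,
i.e. `X^c(v) = κ(TX(v))` where `κ` is the canonical involution of `TTQ`, which is
`(q, u; a, b) ↦ (q, a; u, b)` in bundle coordinates. Tangent vectors to `TQ` at a point over `q`
are represented as pairs `(a, b)` in the bundle chart given by the preferred chart of `Q` at `q`,
in which `T_v X` is `(v, DX(v))`. -/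
def completeLift (X : VField 𝓘(ℝ, E) Q) : VField (IT E) (TB E Q) :=
  fun v => ((X v.proj : E),
    (mfderiv 𝓘(ℝ, E) (IT E) (fun q : Q => (⟨q, X q⟩ : TB E Q)) v.proj v.snd : E × E).2)

/-- The vertical endomorphism `S = dq^i ⊗ ∂/∂q̇^i` of `TTQ`: `S(u)` is the vertical lift of
`Tτ_Q(u)`. -/
def vertEndo (v : TB E Q) : TangentSpace (IT E) v →L[ℝ] TangentSpace (IT E) v :=
  (vlift v).comp (mfderiv (IT E) 𝓘(ℝ, E) (fun x : TB E Q => x.proj) v)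

/-- `S` applied to a vector field on `TQ`. -/
def vertEndoField (Y : VField (IT E) (TB E Q)) : VField (IT E) (TB E Q) :=
  fun v => vertEndo v (Y v)

/-- The adjoint of the vertical endomorphism, `(S^* α)(u) = α(S u)`. -/
def vertEndoAdj (α : OneForm (IT E) (TB E Q)) : OneForm (IT E) (TB E Q) :=
  fun v => (α v).comp (vertEndo v)

/-- The Rayleigh force `S^*(dℛ)` with dissipation function `ℛ`; in bundle coordinates
`(∂ℛ/∂q̇^i) dq^i`. -/
def rayleighForce (R : TB E Q → ℝ) : OneForm (IT E) (TB E Q) :=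
  vertEndoAdj (differential (IT E) R)

/-- The Poincaré–Cartan 1-form `α_L = S^*(dL)`. -/
def cartanOneForm (L : TB E Q → ℝ) : OneForm (IT E) (TB E Q) :=
  vertEndoAdj (differential (IT E) L)

/-- The Poincaré–Cartan 2-form `ω_L = -dα_L`. -/
def cartanTwoForm (L : TB E Q → ℝ) (v : TB E Q) (u w : TangentSpace (IT E) v) : ℝ :=
  -dOneForm (IT E) (cartanOneForm L) v u w

/-- The energy `E_L = Δ(L) - L`. -/
def energy (L : TB E Q → ℝ) : TB E Q → ℝ :=
  fun v => applyField (IT E) liouville L v - L v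

/-- `L` is regular: at every `v ∈ T_q Q` the Hessian `(∂²L/∂q̇^i∂q̇^j)`, i.e. the second derivative
of the restriction of `L` to the fibre `T_q Q`, is a nondegenerate bilinear form (equivalently, in
finite dimension, an invertible matrix). -/
def IsRegularLagrangian (L : TB E Q → ℝ) : Prop :=
  ∀ v : TB E Q, ∀ a : E,
    (∀ b : E, fderiv ℝ (fderiv ℝ (fun w : E => L ⟨v.proj, w⟩)) v.snd a b = 0) → a = 0

/-- `ξ` is a forced Euler–Lagrange vector field of `(L, β)`: `ι_ξ ω_L = dE_L + β`. -/
def IsForcedELField (L : TB E Q → ℝ) (β : OneForm (IT E) (TB E Q))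
    (ξ : VField (IT E) (TB E Q)) : Prop :=
  ∀ (v : TB E Q) (w : TangentSpace (IT E) v),
    cartanTwoForm L v (ξ v) w = differential (IT E) (energy L) v w + β v w

/-- `f` is a constant of the motion of the dynamics `ξ`: `ξ(f) = 0`. -/
def IsConstantOfMotion (ξ : VField (IT E) (TB E Q)) (f : TB E Q → ℝ) : Prop :=
  ∀ v : TB E Q, applyField (IT E) ξ f v = 0

end TangentBundle

end ForcedLagrangian

end

open ForcedLagrangian

/-!
Everything is proved at one point `v ∈ TQ`, in the preferred chart there, where the tangent space of
`TQ` is `E × E` and the claims become identities between first and second derivatives on `E × E`.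

Exterior and Lie derivatives involve the objects near `v` and not only at `v`, while Mathlib
represents the tangent space at a nearby point through the chart preferred at *that* point. So the
coordinate formulas for `X^v`, `X^c`, `Δ` and `S` must be known to hold throughout a fixed chart.
A change of chart of `TQ` is `(x, u) ↦ (τ x, Dτ(x) u)` with `τ` a change of chart of `Q`, and its
derivative `tangentChartDeriv_apply` yields these formulas; for `X^c` the symmetry of `D²τ` is the
point (`completeLift_eq_tangentChartDeriv`).

Write `ℓ`, `r` and `X̂` for the coordinate expressions of `L`, `ℛ` and `X`. The form `S^*(df)` is
`(a, b) ↦ Df(0, a)`, hence `d(S^*(df))(u, w) = D²f(u)(0, w₁) - D²f(w)(0, u₁)`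
(`dOneForm_cartanOneForm`). The statements on `β` follow from the symmetry of `D²r`. For the
dynamics, `ι_u ω_L = dE_L + β` tested on vertical vectors gives `u₁ = q̇` by regularity, and on
horizontal ones `D²ℓ(u)(0, a) = Dℓ(a, 0) - Dr(0, a)` (`forcedEL_at_iff`); regularity and finite
dimension solve these uniquely for `u₂`. Taking `a = X̂` and adding `Dℓ(0, DX̂ · q̇)` turns the last
identity into `ξ(X^v(L)) = X^c(L) - X^v(ℛ)` (`applyField_verticalLift_eq_sub`), from which the
equivalence is immediate.
-/

open Set Filter Topology

namespace ForcedLagrangian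

/-! ### Differentials and charts -/

theorem mdifferentiableAt_extChartAt_symm {F H M : Type*} [NormedAddCommGroup F] [NormedSpace ℝ F]
    [TopologicalSpace H] {I : ModelWithCorners ℝ F H} [I.Boundaryless]
    [TopologicalSpace M] [ChartedSpace H M] [IsManifold I 1 M] {p : M} {y : F}
    (hy : y ∈ (extChartAt I p).target) :
    MDifferentiableAt 𝓘(ℝ, F) I (extChartAt I p).symm y := by
  have := mdifferentiableWithinAt_extChartAt_symm hy
  rwa [I.range_eq_univ, mdifferentiableWithinAt_univ] at this

theorem mvfderiv_mfderiv_extChartAt_symm {F H M : Type*} [NormedAddCommGroup F] [NormedSpace ℝ F]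
    [TopologicalSpace H] {I : ModelWithCorners ℝ F H} [I.Boundaryless]
    [TopologicalSpace M] [ChartedSpace H M] [IsManifold I 1 M] {p : M} {y : F}
    (hy : y ∈ (extChartAt I p).target) {f : M → ℝ}
    (hf : MDifferentiableAt I 𝓘(ℝ, ℝ) f ((extChartAt I p).symm y)) (w : F) :
    mvfderiv I f ((extChartAt I p).symm y) (mfderiv 𝓘(ℝ, F) I (extChartAt I p).symm y w) =
      fderiv ℝ (f ∘ (extChartAt I p).symm) y w := by
  have := mfderiv_comp_apply (I := 𝓘(ℝ, F)) y hf (mdifferentiableAt_extChartAt_symm hy) w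
  rw [mfderiv_eq_fderiv] at this
  exact this.symm

/-- Since `TangentSpace I p` is identified with the model space through the preferred chart at
`p`, the differential of `f` at `p` is the derivative of its expression in that chart. -/
theorem mvfderiv_of_hasFDerivAt {F H M : Type*} [NormedAddCommGroup F] [NormedSpace ℝ F]
    [TopologicalSpace H] {I : ModelWithCorners ℝ F H}
    [TopologicalSpace M] [ChartedSpace H M] [IsManifold I 1 M] {p : M} {f : M → ℝ}
    {f' : F →L[ℝ] ℝ}
    (hf : HasFDerivAt (f ∘ (extChartAt I p).symm) f' (extChartAt I p p)) (w : F) :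
    mvfderiv I f p w = f' w := by
  have h1 := hf.hasMFDerivAt.comp p
    (mdifferentiableAt_extChartAt (I := I) (mem_chart_source H p)).hasMFDerivAt
  have h2 : f =ᶠ[𝓝 p] (f ∘ (extChartAt I p).symm) ∘ extChartAt I p := by
    filter_upwards [extChartAt_source_mem_nhds (I := I) p] with z hz
    simp only [Function.comp, PartialEquiv.left_inv _ hz]
  have h3 := (h1.congr_of_eventuallyEq h2).mfderiv
  rw [mfderiv_extChartAt_self] at h3
  exact congr($h3 w)

/-- The identity `dα(u, w) = (D_u α)(w) - (D_w α)(u)` at the centre of the preferred chart. -/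
theorem dOneForm_eq {F H M : Type*} [NormedAddCommGroup F] [NormedSpace ℝ F]
    [TopologicalSpace H] {I : ModelWithCorners ℝ F H}
    [TopologicalSpace M] [ChartedSpace H M] [IsManifold I 1 M] {α : OneForm I M} {p : M}
    {α' : F →L[ℝ] F →L[ℝ] ℝ} (h : HasFDerivAt (inChart I α p) α' (extChartAt I p p)) (u w : F) :
    dOneForm I α p u w = α' u w - α' w u := by
  have hc : ∀ c : F, HasFDerivAt (fun y => inChart I α p y c) (α'.flip c) (extChartAt I p p) :=
    fun c => (h.clm_apply (hasFDerivAt_const c _)).congr_fderiv (by ext; simp)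
  have hd : DifferentiableAt ℝ (fun y => ContinuousAlternatingMap.ofSubsingleton ℝ F ℝ (0 : Fin 1)
      (inChart I α p y)) (extChartAt I p p) :=
    (ContinuousAlternatingMap.ofSubsingletonLIE (𝕜 := ℝ) (E := F) (F := ℝ)
      (0 : Fin 1)).toContinuousLinearEquiv.differentiableAt.comp _ h.differentiableAt
  unfold dOneForm
  rw [extDeriv_apply hd, mfderiv_extChartAt_self, Fin.sum_univ_two]
  refine (congrArg₂ (fun a b : ℝ => (-1) ^ 0 • a + (-1) ^ 1 • b)
    congr($((hc w).fderiv) u) congr($((hc u).fderiv) w)).trans ?_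
  simp [sub_eq_add_neg]

section TangentBundleCharts

variable {E : Type*} [NormedAddCommGroup E] [NormedSpace ℝ E]
  {Q : Type*} [TopologicalSpace Q] [ChartedSpace E Q] [IsManifold 𝓘(ℝ, E) ∞ Q]

/-! ### The charts of the tangent bundle -/

theorem mem_extChartAt_tangent_target_iff (v : TB E Q) {y : E × E} :
    y ∈ (extChartAt (IT E) v).target ↔ y.1 ∈ (extChartAt 𝓘(ℝ, E) v.proj).target := by
  rw [FiberBundle.extChartAt_target]
  simp +contextual

/-- The charts of `TQ` are the tangent maps of the charts of `Q`. -/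
theorem extChartAt_tangent_apply (v z : TB E Q)
    (hz : z.proj ∈ (extChartAt 𝓘(ℝ, E) v.proj).source) :
    extChartAt (IT E) v z = (extChartAt 𝓘(ℝ, E) v.proj z.proj,
      (mfderiv 𝓘(ℝ, E) 𝓘(ℝ, E) (extChartAt 𝓘(ℝ, E) v.proj) z.proj z.snd : E)) := by
  rw [extChartAt_source] at hz
  have h := congr($(TangentBundle.continuousLinearMapAt_trivializationAt hz) z.snd)
  rw [Bundle.Trivialization.continuousLinearMapAt_apply,
    Bundle.Trivialization.coe_linearMapAt_of_mem _ (by simpa using hz)] at h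
  rw [FiberBundle.extChartAt]
  exact Prod.ext rfl h

theorem mfderiv_extChartAt_mfderiv_symm {x : E} {q : Q} (hx : x ∈ (extChartAt 𝓘(ℝ, E) q).target)
    (u : E) :
    (mfderiv 𝓘(ℝ, E) 𝓘(ℝ, E) (extChartAt 𝓘(ℝ, E) q) ((extChartAt 𝓘(ℝ, E) q).symm x)
      (mfderiv 𝓘(ℝ, E) 𝓘(ℝ, E) (extChartAt 𝓘(ℝ, E) q).symm x u) : E) = u := by
  have := mfderiv_extChartAt_comp_mfderivWithin_extChartAt_symm (I := 𝓘(ℝ, E)) hx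
  rw [modelWithCornersSelf_coe, range_id, mfderivWithin_univ] at this
  exact congr($this u)

theorem extChartAt_tangent_symm_apply (v : TB E Q) (y : E × E)
    (hy : y.1 ∈ (extChartAt 𝓘(ℝ, E) v.proj).target) :
    (extChartAt (IT E) v).symm y = ⟨(extChartAt 𝓘(ℝ, E) v.proj).symm y.1,
      mfderiv 𝓘(ℝ, E) 𝓘(ℝ, E) (extChartAt 𝓘(ℝ, E) v.proj).symm y.1 y.2⟩ := by
  set z : TB E Q := ⟨(extChartAt 𝓘(ℝ, E) v.proj).symm y.1,
      mfderiv 𝓘(ℝ, E) 𝓘(ℝ, E) (extChartAt 𝓘(ℝ, E) v.proj).symm y.1 y.2⟩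
  have hz : z.proj ∈ (extChartAt 𝓘(ℝ, E) v.proj).source := PartialEquiv.map_target _ hy
  have h1 : extChartAt (IT E) v z = y := by
    rw [extChartAt_tangent_apply v z hz]
    exact Prod.ext (PartialEquiv.right_inv (extChartAt 𝓘(ℝ, E) v.proj) hy)
      (mfderiv_extChartAt_mfderiv_symm hy y.2)
  rw [← h1, PartialEquiv.left_inv]
  rw [extChartAt_source] at hz ⊢
  simpa using hz

theorem eventually_fst_mem_target {E Q : Type*} [NormedAddCommGroup E] [NormedSpace ℝ E]
    [TopologicalSpace Q] [ChartedSpace E Q] (v : TB E Q) {y : E × E}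
    (hy : y.1 ∈ (extChartAt 𝓘(ℝ, E) v.proj).target) :
    ∀ᶠ z in 𝓝 y, z.1 ∈ (extChartAt 𝓘(ℝ, E) v.proj).target :=
  continuous_fst.continuousAt.eventually ((isOpen_extChartAt_target v.proj).mem_nhds hy)

theorem extChartAt_tangent_mk (v : TB E Q) (w : TangentSpace 𝓘(ℝ, E) v.proj) :
    extChartAt (IT E) v ⟨v.proj, w⟩ = (extChartAt 𝓘(ℝ, E) v.proj v.proj, (w : E)) := by
  refine (extChartAt_tangent_apply v ⟨v.proj, w⟩ (mem_extChartAt_source _)).trans ?_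
  exact Prod.ext rfl congr($(mfderiv_extChartAt_self (I := 𝓘(ℝ, E)) (x := v.proj)) w)

theorem extChartAt_tangent_self (v : TB E Q) :
    extChartAt (IT E) v v = (extChartAt 𝓘(ℝ, E) v.proj v.proj, (v.snd : E)) :=
  extChartAt_tangent_mk v v.snd

theorem extChartAt_tangent_symm_mk (v : TB E Q) (w : E) :
    (extChartAt (IT E) v).symm (extChartAt 𝓘(ℝ, E) v.proj v.proj, w) = ⟨v.proj, w⟩ := by
  refine (congrArg _ (extChartAt_tangent_mk v w)).symm.trans (PartialEquiv.left_inv _ ?_)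
  rw [extChartAt_source]
  simp

theorem extChartAt_tangent_self_fst_mem (v : TB E Q) :
    (extChartAt (IT E) v v).1 ∈ (extChartAt 𝓘(ℝ, E) v.proj).target := by
  rw [← mem_extChartAt_tangent_target_iff]; exact mem_extChartAt_target v

/-! ### The vertical lift and the vertical endomorphism at a point -/

theorem hasMFDerivAt_fiberIncl (v : TB E Q) :
    HasMFDerivAt 𝓘(ℝ, E) (IT E) (fun w : E => (⟨v.proj, w⟩ : TB E Q)) v.snd
     (ContinuousLinearMap.inr ℝ E E : E →L[ℝ] E × E) := by
  constructor
  · have h2 := (mdifferentiableAt_extChartAt_symm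
      (mem_extChartAt_target (I := IT E) v)).continuousAt
    rw [extChartAt_tangent_self] at h2
    have h3 : ContinuousAt (fun w : E => (extChartAt 𝓘(ℝ, E) v.proj v.proj, w)) v.snd :=
      (Continuous.prodMk_right _).continuousAt
    have := ContinuousAt.comp (f := fun w : E => (extChartAt 𝓘(ℝ, E) v.proj v.proj, w)) h2 h3
    refine this.congr (Eventually.of_forall fun w => extChartAt_tangent_symm_mk v w)
  · refine HasFDerivAt.hasFDerivWithinAt ?_
    have h4 : HasFDerivAt (fun w : E => (extChartAt 𝓘(ℝ, E) v.proj v.proj, w))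
      (ContinuousLinearMap.inr ℝ E E) v.snd := hasFDerivAt_prodMk_right _ _
    exact h4.congr_of_eventuallyEq (Eventually.of_forall fun w => extChartAt_tangent_mk v w)

theorem hasMFDerivAt_proj (v : TB E Q) :
    HasMFDerivAt (IT E) 𝓘(ℝ, E) (fun x : TB E Q => x.proj) v
     (ContinuousLinearMap.fst ℝ E E : E × E →L[ℝ] E) := by
  refine ⟨(FiberBundle.continuous_proj E (TangentSpace 𝓘(ℝ, E))).continuousAt,
    HasFDerivAt.hasFDerivWithinAt ?_⟩
  refine (hasFDerivAt_fst).congr_of_eventuallyEq ?_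
  filter_upwards [eventually_fst_mem_target v (extChartAt_tangent_self_fst_mem v)] with z hz
  simp only [writtenInExtChartAt, Function.comp]
  rw [extChartAt_tangent_symm_apply v z hz]
  exact PartialEquiv.right_inv _ hz

theorem vlift_apply (v : TB E Q) (a : TangentSpace 𝓘(ℝ, E) v.proj) :
    (vlift v a : E × E) = ((0 : E), (a : E)) :=
  congr($((hasMFDerivAt_fiberIncl v).mfderiv) a)

theorem vertEndo_apply (v : TB E Q) (w : TangentSpace (IT E) v) :
    (vertEndo v w : E × E) = ((0 : E), (w : E × E).1) :=
  (vlift_apply v _).trans congr(((0 : E), $(congr($((hasMFDerivAt_proj v).mfderiv) w))))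

/-! ### Changes of chart -/

/-- The transition map `τ` from the preferred chart of `Q` at `q` to the preferred chart at the
point with coordinate `x` in the former. Its derivative at `x` reads tangent vectors at that point,
given in the chart at `q`, in the identification `TangentSpace = E` used by Mathlib. -/
noncomputable def baseTransition (q : Q) (x : E) : E → E :=
  extChartAt 𝓘(ℝ, E) ((extChartAt 𝓘(ℝ, E) q).symm x) ∘ (extChartAt 𝓘(ℝ, E) q).symm

/-- The derivative at `y` of the inverse of the preferred chart of `TQ` at `v`, as a map between
model spaces: the target `T(TQ)` at the image of `y` is identified with `E × E` through the
preferred chart at that image. -/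
noncomputable def tangentChartDeriv (v : TB E Q) (y : E × E) : E × E →L[ℝ] E × E :=
  mfderiv 𝓘(ℝ, E × E) (IT E) (extChartAt (IT E) v).symm y

theorem mfderiv_extChartAt_symm_eq_fderiv (q : Q) {x : E}
    (hx : x ∈ (extChartAt 𝓘(ℝ, E) q).target) (u : E) :
    (mfderiv 𝓘(ℝ, E) 𝓘(ℝ, E) (extChartAt 𝓘(ℝ, E) q).symm x u : E) =
      fderiv ℝ (baseTransition q x) x u := by
  rw [(mdifferentiableAt_extChartAt_symm hx).mfderiv, modelWithCornersSelf_coe, range_id,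
    fderivWithin_univ]
  rfl

theorem contDiffAt_baseTransition (q : Q) {x : E} (hx : x ∈ (extChartAt 𝓘(ℝ, E) q).target) :
    ContDiffAt ℝ ∞ (baseTransition q x) x := by
  have := contDiffWithinAt_ext_coord_change (n := ∞) (I := 𝓘(ℝ, E))
    ((extChartAt 𝓘(ℝ, E) q).symm x) q (y := x) (by
      simp only [PartialEquiv.trans_source, PartialEquiv.symm_source]
      exact ⟨hx, mem_extChartAt_source _⟩)
  rwa [modelWithCornersSelf_coe, range_id, contDiffWithinAt_univ] at this

theorem eventually_mem_chart_overlap (q : Q) {x : E} (hx : x ∈ (extChartAt 𝓘(ℝ, E) q).target) :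
    ∀ᶠ z in 𝓝 x, z ∈ (extChartAt 𝓘(ℝ, E) q).target ∧ (extChartAt 𝓘(ℝ, E) q).symm z ∈
      (extChartAt 𝓘(ℝ, E) ((extChartAt 𝓘(ℝ, E) q).symm x)).source := by
  refine Eventually.and ((isOpen_extChartAt_target q).mem_nhds hx) ?_
  exact (mdifferentiableAt_extChartAt_symm hx).continuousAt.eventually
    (extChartAt_source_mem_nhds _)

theorem mfderiv_comp_mfderiv_symm_eq_fderiv (q : Q) {x z : E}
    (hz : z ∈ (extChartAt 𝓘(ℝ, E) q).target)
    (hz' : (extChartAt 𝓘(ℝ, E) q).symm z ∈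
      (extChartAt 𝓘(ℝ, E) ((extChartAt 𝓘(ℝ, E) q).symm x)).source) (u : E) :
    (mfderiv 𝓘(ℝ, E) 𝓘(ℝ, E) (extChartAt 𝓘(ℝ, E) ((extChartAt 𝓘(ℝ, E) q).symm x))
      ((extChartAt 𝓘(ℝ, E) q).symm z)
      (mfderiv 𝓘(ℝ, E) 𝓘(ℝ, E) (extChartAt 𝓘(ℝ, E) q).symm z u) : E) =
      fderiv ℝ (baseTransition q x) z u := by
  rw [extChartAt_source] at hz'
  have := mfderiv_comp_apply (I := 𝓘(ℝ, E)) z (mdifferentiableAt_extChartAt (I := 𝓘(ℝ, E)) hz')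
    (mdifferentiableAt_extChartAt_symm hz) u
  rw [mfderiv_eq_fderiv] at this
  exact this.symm

/-- In coordinates a change of chart of `TQ` is `(x, u) ↦ (τ x, Dτ(x) u)`; this is its
derivative. The naturality of all canonical structures of `TQ` below is read off from it. -/
theorem tangentChartDeriv_apply (v : TB E Q) {y : E × E}
    (hy : y.1 ∈ (extChartAt 𝓘(ℝ, E) v.proj).target) (w : E × E) :
    tangentChartDeriv v y w = (fderiv ℝ (baseTransition v.proj y.1) y.1 w.1,
      fderiv ℝ (fderiv ℝ (baseTransition v.proj y.1)) y.1 w.1 y.2 +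
        fderiv ℝ (baseTransition v.proj y.1) y.1 w.2) := by
  set τ := baseTransition v.proj y.1 with hτ
  have hd := contDiffAt_baseTransition v.proj hy
  have h1 : HasFDerivAt τ (fderiv ℝ τ y.1) y.1 :=
    (hd.differentiableAt (by simp)).hasFDerivAt
  have h2 : HasFDerivAt (fderiv ℝ τ) (fderiv ℝ (fderiv ℝ τ) y.1) y.1 :=
    ((hd.fderiv_right (m := ∞) (by simp)).differentiableAt (by simp)).hasFDerivAt
  have h3 := (h1.comp y hasFDerivAt_fst).prodMk
    ((h2.comp y hasFDerivAt_fst).clm_apply hasFDerivAt_snd)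
  have h4 : writtenInExtChartAt 𝓘(ℝ, E × E) (IT E) y (extChartAt (IT E) v).symm =ᶠ[𝓝 y]
      fun z => ((τ ∘ Prod.fst) z, (fderiv ℝ τ ∘ Prod.fst) z z.2) := by
    filter_upwards [continuous_fst.continuousAt.eventually (eventually_mem_chart_overlap v.proj hy)]
      with z hz
    simp only [writtenInExtChartAt, Function.comp]
    have hp : ((extChartAt (IT E) v).symm y).proj = (extChartAt 𝓘(ℝ, E) v.proj).symm y.1 := by
      rw [extChartAt_tangent_symm_apply v y hy]
    have hz2 := extChartAt_tangent_apply ((extChartAt (IT E) v).symm y)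
      ((extChartAt (IT E) v).symm z)
      (by rw [extChartAt_tangent_symm_apply v z hz.1, hp]; exact hz.2)
    refine hz2.trans ?_
    rw [extChartAt_tangent_symm_apply v z hz.1, hp]
    exact Prod.ext rfl (mfderiv_comp_mfderiv_symm_eq_fderiv v.proj hz.1 hz.2 z.2)
  have h5 := (h3.congr_of_eventuallyEq h4).fderiv
  rw [tangentChartDeriv,
    (mdifferentiableAt_extChartAt_symm ((mem_extChartAt_tangent_target_iff v).2 hy)).mfderiv,
    modelWithCornersSelf_coe, range_id, fderivWithin_univ]
  refine congr($h5 w).trans ?_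
  simp [add_comm]

theorem tangentChartDeriv_vertical (v : TB E Q) {y : E × E}
    (hy : y.1 ∈ (extChartAt 𝓘(ℝ, E) v.proj).target) (a : E) :
    tangentChartDeriv v y (0, a) = (0, fderiv ℝ (baseTransition v.proj y.1) y.1 a) := by
  rw [tangentChartDeriv_apply v hy]
  simp

theorem mvfderiv_tangentChartDeriv (v : TB E Q) {y : E × E}
    (hy : y.1 ∈ (extChartAt 𝓘(ℝ, E) v.proj).target) {f : TB E Q → ℝ}
    (hf : ContMDiff (IT E) 𝓘(ℝ, ℝ) ∞ f) (w : E × E) :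
    mvfderiv (IT E) f ((extChartAt (IT E) v).symm y) (tangentChartDeriv v y w) =
      fderiv ℝ (f ∘ (extChartAt (IT E) v).symm) y w :=
  mvfderiv_mfderiv_extChartAt_symm ((mem_extChartAt_tangent_target_iff v).2 hy)
    (hf.mdifferentiableAt (by simp)) w

/-! ### Coordinate expressions of lifts -/

/-- The coordinate expression `X̂` of a vector field on `Q` in the preferred chart at `q`. -/
noncomputable def fieldInChart (X : VField 𝓘(ℝ, E) Q) (q : Q) (x : E) : E :=
  mfderiv 𝓘(ℝ, E) 𝓘(ℝ, E) (extChartAt 𝓘(ℝ, E) q) ((extChartAt 𝓘(ℝ, E) q).symm x)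
    (X ((extChartAt 𝓘(ℝ, E) q).symm x))

theorem mfderiv_symm_fieldInChart (X : VField 𝓘(ℝ, E) Q) (q : Q) {x : E}
    (hx : x ∈ (extChartAt 𝓘(ℝ, E) q).target) :
    (mfderiv 𝓘(ℝ, E) 𝓘(ℝ, E) (extChartAt 𝓘(ℝ, E) q).symm x
      (fieldInChart (E := E) X q x) : E) =
      X ((extChartAt 𝓘(ℝ, E) q).symm x) := by
  have := mfderivWithin_extChartAt_symm_comp_mfderiv_extChartAt (I := 𝓘(ℝ, E)) hx
  rw [modelWithCornersSelf_coe, range_id, mfderivWithin_univ] at this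
  exact congr($this (X ((extChartAt 𝓘(ℝ, E) q).symm x)))

theorem fieldInChart_self (X : VField 𝓘(ℝ, E) Q) (q : Q) :
    fieldInChart X q (extChartAt 𝓘(ℝ, E) q q) = X q := by
  rw [fieldInChart, extChartAt_to_inv]
  exact congr($(mfderiv_extChartAt_self (I := 𝓘(ℝ, E)) (x := q)) (X q))

/-- The transformation law of vector fields under a change of chart. -/
theorem fieldInChart_transition (X : VField 𝓘(ℝ, E) Q) (q : Q) {x z : E}
    (hz : z ∈ (extChartAt 𝓘(ℝ, E) q).target)
    (hz' : (extChartAt 𝓘(ℝ, E) q).symm z ∈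
      (extChartAt 𝓘(ℝ, E) ((extChartAt 𝓘(ℝ, E) q).symm x)).source) :
    fieldInChart X ((extChartAt 𝓘(ℝ, E) q).symm x) (baseTransition q x z) =
      fderiv ℝ (baseTransition q x) z (fieldInChart X q z) := by
  rw [← mfderiv_comp_mfderiv_symm_eq_fderiv q hz hz', mfderiv_symm_fieldInChart X q hz,
    fieldInChart, baseTransition, Function.comp, PartialEquiv.left_inv _ hz']

theorem extChartAt_tangent_field (X : VField 𝓘(ℝ, E) Q) (q : Q) {x : E}
    (hx : x ∈ (extChartAt 𝓘(ℝ, E) q).target) :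
    extChartAt (IT E) (⟨q, X q⟩ : TB E Q)
      ⟨(extChartAt 𝓘(ℝ, E) q).symm x, X ((extChartAt 𝓘(ℝ, E) q).symm x)⟩ =
      (x, fieldInChart X q x) := by
  refine (extChartAt_tangent_apply (⟨q, X q⟩ : TB E Q) ⟨(extChartAt 𝓘(ℝ, E) q).symm x,
    X ((extChartAt 𝓘(ℝ, E) q).symm x)⟩ (PartialEquiv.map_target _ hx)).trans ?_
  exact Prod.ext (PartialEquiv.right_inv (extChartAt 𝓘(ℝ, E) q) hx) rfl

theorem contDiffAt_fieldInChart {X : VField 𝓘(ℝ, E) Q}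
    (hX : ContMDiff 𝓘(ℝ, E) (IT E) ∞ (fun q : Q => (⟨q, X q⟩ : TB E Q))) (q : Q) {x : E}
    (hx : x ∈ (extChartAt 𝓘(ℝ, E) q).target) : ContDiffAt ℝ ∞ (fieldInChart X q) x := by
  have h1 : ContMDiffAt 𝓘(ℝ, E) 𝓘(ℝ, E) ∞ (extChartAt 𝓘(ℝ, E) q).symm x :=
    (contMDiffOn_extChartAt_symm q).contMDiffAt ((isOpen_extChartAt_target q).mem_nhds hx)
  have h2 := (hX ((extChartAt 𝓘(ℝ, E) q).symm x)).comp x h1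
  have h3 : ContMDiffAt (IT E) 𝓘(ℝ, E × E) ∞ (extChartAt (IT E) (⟨q, X q⟩ : TB E Q))
      ⟨(extChartAt 𝓘(ℝ, E) q).symm x, X ((extChartAt 𝓘(ℝ, E) q).symm x)⟩ := by
    apply contMDiffAt_extChartAt'
    have := PartialEquiv.map_target _ hx
    rw [extChartAt_source] at this
    simpa using this
  have h4 := (h3.comp x h2).contDiffAt.snd
  refine h4.congr_of_eventuallyEq ?_
  filter_upwards [(isOpen_extChartAt_target (I := 𝓘(ℝ, E)) q).mem_nhds hx] with z hz
  exact congr(($(extChartAt_tangent_field X q hz)).2).symm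

theorem hasFDerivAt_fieldInChart {X : VField 𝓘(ℝ, E) Q}
    (hX : ContMDiff 𝓘(ℝ, E) (IT E) ∞ (fun q : Q => (⟨q, X q⟩ : TB E Q))) (v : TB E Q) :
    HasFDerivAt (fieldInChart X v.proj)
      (fderiv ℝ (fieldInChart X v.proj) (extChartAt (IT E) v v).1) (extChartAt (IT E) v v).1 :=
  ((contDiffAt_fieldInChart hX v.proj (extChartAt_tangent_self_fst_mem v)).differentiableAt
    (by simp)).hasFDerivAt

theorem mfderiv_field_snd {X : VField 𝓘(ℝ, E) Q}
    (hX : ContMDiff 𝓘(ℝ, E) (IT E) ∞ (fun q : Q => (⟨q, X q⟩ : TB E Q))) (q : Q) (w : E) :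
    (mfderiv 𝓘(ℝ, E) (IT E) (fun q : Q => (⟨q, X q⟩ : TB E Q)) q w : E × E).2 =
      fderiv ℝ (fieldInChart X q) (extChartAt 𝓘(ℝ, E) q q) w := by
  rw [(hX.mdifferentiableAt (by simp)).mfderiv, modelWithCornersSelf_coe, range_id,
    fderivWithin_univ]
  have h1 : writtenInExtChartAt 𝓘(ℝ, E) (IT E) q (fun q : Q => (⟨q, X q⟩ : TB E Q))
      =ᶠ[𝓝 (extChartAt 𝓘(ℝ, E) q q)] fun x => (x, fieldInChart X q x) := by
    filter_upwards [(isOpen_extChartAt_target (I := 𝓘(ℝ, E)) q).mem_nhds (mem_extChartAt_target q)]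
      with z hz
    exact extChartAt_tangent_field X q hz
  have h2 := ((contDiffAt_fieldInChart hX q (mem_extChartAt_target q)).differentiableAt
    (by simp)).hasFDerivAt
  have h3 := (((hasFDerivAt_id _).prodMk h2).congr_of_eventuallyEq h1).fderiv
  exact congr(($h3 w).2)

/-- The complete lift at `v`, with the derivative of `X` taken in the chart at the base point of
`v`. -/
theorem completeLift_eq_base_chart {X : VField 𝓘(ℝ, E) Q}
    (hX : ContMDiff 𝓘(ℝ, E) (IT E) ∞ (fun q : Q => (⟨q, X q⟩ : TB E Q))) (v : TB E Q) :
    (completeLift X v : E × E) = (fieldInChart X v.proj (extChartAt 𝓘(ℝ, E) v.proj v.proj),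
      fderiv ℝ (fieldInChart X v.proj) (extChartAt 𝓘(ℝ, E) v.proj v.proj) v.snd) :=
  Prod.ext (fieldInChart_self X v.proj).symm (mfderiv_field_snd hX v.proj v.snd)

theorem completeLift_eq_fieldInChart {X : VField 𝓘(ℝ, E) Q}
    (hX : ContMDiff 𝓘(ℝ, E) (IT E) ∞ (fun q : Q => (⟨q, X q⟩ : TB E Q))) (v : TB E Q) :
    (completeLift X v : E × E) = (fieldInChart X v.proj (extChartAt (IT E) v v).1,
      fderiv ℝ (fieldInChart X v.proj) (extChartAt (IT E) v v).1 (extChartAt (IT E) v v).2) := by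
  refine (completeLift_eq_base_chart hX v).trans ?_
  rw [extChartAt_tangent_self]

/-- The coordinate formula `X^c = (X̂, DX̂ · q̇)` holds in any chart of `TQ`, not only at the centre
of the preferred one, by which `completeLift` is defined. -/
theorem completeLift_eq_tangentChartDeriv {X : VField 𝓘(ℝ, E) Q}
    (hX : ContMDiff 𝓘(ℝ, E) (IT E) ∞ (fun q : Q => (⟨q, X q⟩ : TB E Q))) (v : TB E Q) {y : E × E}
    (hy : y.1 ∈ (extChartAt 𝓘(ℝ, E) v.proj).target) :
    (completeLift X ((extChartAt (IT E) v).symm y) : E × E) =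
      tangentChartDeriv v y
        (fieldInChart X v.proj y.1, fderiv ℝ (fieldInChart X v.proj) y.1 y.2) := by
  have hp := extChartAt_tangent_symm_apply v y hy
  rw [tangentChartDeriv_apply v hy, completeLift_eq_base_chart hX, hp]
  set τ := baseTransition v.proj y.1 with hτ
  have hd := contDiffAt_baseTransition v.proj hy
  have h1 : HasFDerivAt τ (fderiv ℝ τ y.1) y.1 :=
    (hd.differentiableAt (by simp)).hasFDerivAt
  have h2 : HasFDerivAt (fderiv ℝ τ) (fderiv ℝ (fderiv ℝ τ) y.1) y.1 :=
    ((hd.fderiv_right (m := ∞) (by simp)).differentiableAt (by simp)).hasFDerivAt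
  have hsymm : IsSymmSndFDerivAt ℝ τ y.1 := hd.isSymmSndFDerivAt (by simpa using ENat.LEInfty.out)
  set q' := (extChartAt 𝓘(ℝ, E) v.proj).symm y.1
  have h3 := ((contDiffAt_fieldInChart hX q' (mem_extChartAt_target q')).differentiableAt
    (by simp)).hasFDerivAt
  have h4 := ((contDiffAt_fieldInChart hX v.proj hy).differentiableAt (by simp)).hasFDerivAt
  -- Differentiating the transformation law `X̂' ∘ τ = Dτ · X̂` along `y.2` produces both
  -- second-order terms of the claim.
  have h5 : fieldInChart X q' ∘ τ =ᶠ[𝓝 y.1] fun z => fderiv ℝ τ z (fieldInChart X v.proj z) := by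
    filter_upwards [eventually_mem_chart_overlap v.proj hy] with z hz
    exact fieldInChart_transition X v.proj hz.1 hz.2
  have hτy : extChartAt 𝓘(ℝ, E) q' q' = τ y.1 := rfl
  rw [hτy] at h3 ⊢
  have h6 := (h3.comp y.1 h1).unique ((h2.clm_apply h4).congr_of_eventuallyEq h5)
  refine Prod.ext h5.self_of_nhds ?_
  have h7 := congr($h6 y.2)
  -- Symmetry of `D²τ` is what makes the canonical flip compatible with changes of chart.
  rw [← hsymm]
  refine (congrArg (fderiv ℝ (fieldInChart X q') (τ y.1))
    (mfderiv_extChartAt_symm_eq_fderiv v.proj hy y.2)).trans (h7.trans ?_)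
  exact add_comm _ _

/-- The coordinate formula `X^v = (0, X̂)` in any chart of `TQ`. -/
theorem verticalLift_eq_tangentChartDeriv (X : VField 𝓘(ℝ, E) Q) (v : TB E Q) {y : E × E}
    (hy : y.1 ∈ (extChartAt 𝓘(ℝ, E) v.proj).target) :
    (verticalLift X ((extChartAt (IT E) v).symm y) : E × E) =
      tangentChartDeriv v y (0, fieldInChart X v.proj y.1) := by
  refine (vlift_apply _ _).trans ?_
  rw [tangentChartDeriv_vertical v hy, ← mfderiv_extChartAt_symm_eq_fderiv v.proj hy,
    mfderiv_symm_fieldInChart X v.proj hy, extChartAt_tangent_symm_apply v y hy]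
  rfl

/-- The coordinate formula `Δ = (0, q̇)` in any chart of `TQ`. -/
theorem liouville_eq_tangentChartDeriv (v : TB E Q) {y : E × E}
    (hy : y.1 ∈ (extChartAt 𝓘(ℝ, E) v.proj).target) :
    (liouville ((extChartAt (IT E) v).symm y) : E × E) = tangentChartDeriv v y (0, y.2) := by
  refine (vlift_apply _ _).trans ?_
  rw [tangentChartDeriv_vertical v hy, ← mfderiv_extChartAt_symm_eq_fderiv v.proj hy,
    extChartAt_tangent_symm_apply v y hy]
  rfl

/-- The coordinate formula `S(a, b) = (0, a)` in any chart of `TQ`. -/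
theorem vertEndo_tangentChartDeriv (v : TB E Q) {y : E × E}
    (hy : y.1 ∈ (extChartAt 𝓘(ℝ, E) v.proj).target) (w : E × E) :
    (vertEndo ((extChartAt (IT E) v).symm y) (tangentChartDeriv v y w) : E × E) =
      tangentChartDeriv v y (0, w.1) := by
  refine (vertEndo_apply _ _).trans ?_
  rw [tangentChartDeriv_vertical v hy, tangentChartDeriv_apply v hy]

/-! ### Coordinate expressions of derived functions and forms -/

theorem contDiffAt_comp_chart_symm {f : TB E Q → ℝ} (hf : ContMDiff (IT E) 𝓘(ℝ, ℝ) ∞ f) (v : TB E Q)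
    {y : E × E} (hy : y.1 ∈ (extChartAt 𝓘(ℝ, E) v.proj).target) :
    ContDiffAt ℝ ∞ (f ∘ (extChartAt (IT E) v).symm) y := by
  have h1 : ContMDiffAt 𝓘(ℝ, E × E) (IT E) ∞ (extChartAt (IT E) v).symm y :=
    (contMDiffOn_extChartAt_symm v).contMDiffAt
      ((isOpen_extChartAt_target v).mem_nhds ((mem_extChartAt_tangent_target_iff v).2 hy))
  exact ((hf _).comp y h1).contDiffAt

theorem mvfderiv_eq_fderiv_chart {f : TB E Q → ℝ} (hf : ContMDiff (IT E) 𝓘(ℝ, ℝ) ∞ f) (v : TB E Q)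
    (w : E × E) : mvfderiv (IT E) f v w =
      fderiv ℝ (f ∘ (extChartAt (IT E) v).symm) (extChartAt (IT E) v v) w :=
  mvfderiv_of_hasFDerivAt ((contDiffAt_comp_chart_symm hf v
    (extChartAt_tangent_self_fst_mem v)).differentiableAt (by simp)).hasFDerivAt w

theorem hasFDerivAt_fderiv_comp_chart_symm {f : TB E Q → ℝ} (hf : ContMDiff (IT E) 𝓘(ℝ, ℝ) ∞ f)
    (v : TB E Q) :
    HasFDerivAt (fderiv ℝ (f ∘ (extChartAt (IT E) v).symm))
      (fderiv ℝ (fderiv ℝ (f ∘ (extChartAt (IT E) v).symm)) (extChartAt (IT E) v v))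
      (extChartAt (IT E) v v) :=
  (((contDiffAt_comp_chart_symm hf v (extChartAt_tangent_self_fst_mem v)).fderiv_right (m := ∞)
    (by simp)).differentiableAt (by simp)).hasFDerivAt

theorem isSymmSndFDerivAt_comp_chart_symm {f : TB E Q → ℝ} (hf : ContMDiff (IT E) 𝓘(ℝ, ℝ) ∞ f)
    (v : TB E Q) :
    IsSymmSndFDerivAt ℝ (f ∘ (extChartAt (IT E) v).symm) (extChartAt (IT E) v v) :=
  (contDiffAt_comp_chart_symm hf v (extChartAt_tangent_self_fst_mem v)).isSymmSndFDerivAt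
    (by simpa using ENat.LEInfty.out)

theorem applyField_eq_fderiv_chart {f : TB E Q → ℝ} (hf : ContMDiff (IT E) 𝓘(ℝ, ℝ) ∞ f) (v : TB E Q)
    {y : E × E} (hy : y.1 ∈ (extChartAt 𝓘(ℝ, E) v.proj).target) {Y : VField (IT E) (TB E Q)}
    {w : E × E}
    (hY : (Y ((extChartAt (IT E) v).symm y) : E × E) = tangentChartDeriv v y w) :
    applyField (IT E) Y f ((extChartAt (IT E) v).symm y) =
      fderiv ℝ (f ∘ (extChartAt (IT E) v).symm) y w := by
  rw [← mvfderiv_tangentChartDeriv v hy hf w, ← hY]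
  rfl

/-- The derivative of `Y(f)`, for a vector field `Y` with coordinate expression `W`. -/
theorem mvfderiv_applyField {f : TB E Q → ℝ} (hf : ContMDiff (IT E) 𝓘(ℝ, ℝ) ∞ f) (v : TB E Q)
    {Y : VField (IT E) (TB E Q)} {W : E × E → E × E} {W' : E × E →L[ℝ] E × E}
    (hY : ∀ y : E × E, y.1 ∈ (extChartAt 𝓘(ℝ, E) v.proj).target →
      (Y ((extChartAt (IT E) v).symm y) : E × E) = tangentChartDeriv v y (W y))
    (hW : HasFDerivAt W W' (extChartAt (IT E) v v)) (w : E × E) :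
    mvfderiv (IT E) (applyField (IT E) Y f) v w =
      fderiv ℝ (fderiv ℝ (f ∘ (extChartAt (IT E) v).symm)) (extChartAt (IT E) v v) w
        (W (extChartAt (IT E) v v)) +
      fderiv ℝ (f ∘ (extChartAt (IT E) v).symm) (extChartAt (IT E) v v) (W' w) := by
  have h := (hasFDerivAt_fderiv_comp_chart_symm hf v).clm_apply hW
  refine (mvfderiv_of_hasFDerivAt (h.congr_of_eventuallyEq ?_) w).trans ?_
  · filter_upwards [eventually_fst_mem_target v (extChartAt_tangent_self_fst_mem v)] with z hz
    exact applyField_eq_fderiv_chart hf v hz (hY z hz)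
  · simp [add_comm]

theorem mvfderiv_verticalLift {X : VField 𝓘(ℝ, E) Q}
    (hX : ContMDiff 𝓘(ℝ, E) (IT E) ∞ (fun q : Q => (⟨q, X q⟩ : TB E Q)))
    {f : TB E Q → ℝ} (hf : ContMDiff (IT E) 𝓘(ℝ, ℝ) ∞ f) (v : TB E Q) (w : E × E) :
    mvfderiv (IT E) (applyField (IT E) (verticalLift X) f) v w =
      fderiv ℝ (fderiv ℝ (f ∘ (extChartAt (IT E) v).symm)) (extChartAt (IT E) v v) w
        (0, fieldInChart X v.proj (extChartAt (IT E) v v).1) +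
      fderiv ℝ (f ∘ (extChartAt (IT E) v).symm) (extChartAt (IT E) v v)
        (0, fderiv ℝ (fieldInChart X v.proj) (extChartAt (IT E) v v).1 w.1) :=
  mvfderiv_applyField hf v (fun _ hy => verticalLift_eq_tangentChartDeriv X v hy)
    ((hasFDerivAt_const (0 : E) _).prodMk
      ((hasFDerivAt_fieldInChart hX v).comp (extChartAt (IT E) v v) hasFDerivAt_fst)) w

/-- The derivative of `X^c(f)` in vertical directions, where the second derivative of `X̂` does not
enter. -/
theorem mvfderiv_completeLift_vertical {X : VField 𝓘(ℝ, E) Q}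
    (hX : ContMDiff 𝓘(ℝ, E) (IT E) ∞ (fun q : Q => (⟨q, X q⟩ : TB E Q)))
    {f : TB E Q → ℝ} (hf : ContMDiff (IT E) 𝓘(ℝ, ℝ) ∞ f) (v : TB E Q) (a : E) :
    mvfderiv (IT E) (applyField (IT E) (completeLift X) f) v ((0 : E), a) =
      fderiv ℝ (fderiv ℝ (f ∘ (extChartAt (IT E) v).symm)) (extChartAt (IT E) v v) (0, a)
        (fieldInChart X v.proj (extChartAt (IT E) v v).1,
          fderiv ℝ (fieldInChart X v.proj) (extChartAt (IT E) v v).1 (extChartAt (IT E) v v).2) +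
      fderiv ℝ (f ∘ (extChartAt (IT E) v).symm) (extChartAt (IT E) v v)
        (0, fderiv ℝ (fieldInChart X v.proj) (extChartAt (IT E) v v).1 a) := by
  have h1 := (hasFDerivAt_fieldInChart hX v).comp (extChartAt (IT E) v v) hasFDerivAt_fst
  have h2 := (((contDiffAt_fieldInChart hX v.proj (extChartAt_tangent_self_fst_mem v)).fderiv_right
    (m := ∞) (by simp)).differentiableAt (by simp)).hasFDerivAt.comp (extChartAt (IT E) v v)
      hasFDerivAt_fst
  have h3 := h1.prodMk (h2.clm_apply hasFDerivAt_snd)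
  refine (mvfderiv_applyField hf v
    (fun _ hy => completeLift_eq_tangentChartDeriv hX v hy) h3 _).trans ?_
  simp

theorem mvfderiv_energy {L : TB E Q → ℝ} (hL : ContMDiff (IT E) 𝓘(ℝ, ℝ) ∞ L) (v : TB E Q)
    (w : E × E) :
    mvfderiv (IT E) (energy L) v w =
      fderiv ℝ (fderiv ℝ (L ∘ (extChartAt (IT E) v).symm)) (extChartAt (IT E) v v) w
        (0, (extChartAt (IT E) v v).2) -
      fderiv ℝ (L ∘ (extChartAt (IT E) v).symm) (extChartAt (IT E) v v) (w.1, 0) := by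
  have hd := ((contDiffAt_comp_chart_symm hL v (extChartAt_tangent_self_fst_mem v)).differentiableAt
    (by simp)).hasFDerivAt
  have h := ((hasFDerivAt_fderiv_comp_chart_symm hL v).clm_apply
    ((hasFDerivAt_const (0 : E) _).prodMk hasFDerivAt_snd)).sub hd
  refine (mvfderiv_of_hasFDerivAt (h.congr_of_eventuallyEq ?_) w).trans ?_
  · filter_upwards [eventually_fst_mem_target v (extChartAt_tangent_self_fst_mem v)] with z hz
    exact congrArg (· - _)
      (applyField_eq_fderiv_chart hL v hz (liouville_eq_tangentChartDeriv v hz))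
  · have hw : w = (w.1, 0) + (0, w.2) := by simp
    have := congrArg (fderiv ℝ (L ∘ (extChartAt (IT E) v).symm) (extChartAt (IT E) v v)) hw
    rw [map_add] at this
    change fderiv ℝ (L ∘ (extChartAt (IT E) v).symm) (extChartAt (IT E) v v) (0, w.2) +
      fderiv ℝ (fderiv ℝ (L ∘ (extChartAt (IT E) v).symm)) (extChartAt (IT E) v v) w
        (0, (extChartAt (IT E) v v).2) -
      fderiv ℝ (L ∘ (extChartAt (IT E) v).symm) (extChartAt (IT E) v v) w = _
    rw [this]
    ring

/-- The coordinate formula `S^*(df) = (∂f/∂q̇^i) dq^i`. -/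
theorem inChart_cartanOneForm {f : TB E Q → ℝ} (hf : ContMDiff (IT E) 𝓘(ℝ, ℝ) ∞ f) (v : TB E Q)
    {y : E × E} (hy : y.1 ∈ (extChartAt 𝓘(ℝ, E) v.proj).target) :
    inChart (IT E) (cartanOneForm f) v y =
      (fderiv ℝ (f ∘ (extChartAt (IT E) v).symm) y).comp
        ((ContinuousLinearMap.inr ℝ E E).comp (ContinuousLinearMap.fst ℝ E E)) := by
  refine ContinuousLinearMap.ext fun w => ?_
  exact (congrArg (mvfderiv (IT E) f ((extChartAt (IT E) v).symm y))
    (vertEndo_tangentChartDeriv v hy w)).trans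
    (mvfderiv_tangentChartDeriv v hy hf _)

/-- The coordinate formula `d(S^*(df))(u, w) = D²f(u)(0, w₁) - D²f(w)(0, u₁)`. -/
theorem dOneForm_cartanOneForm {f : TB E Q → ℝ} (hf : ContMDiff (IT E) 𝓘(ℝ, ℝ) ∞ f) (v : TB E Q)
    (u w : E × E) :
    dOneForm (IT E) (cartanOneForm f) v u w =
      fderiv ℝ (fderiv ℝ (f ∘ (extChartAt (IT E) v).symm)) (extChartAt (IT E) v v) u (0, w.1) -
      fderiv ℝ (fderiv ℝ (f ∘ (extChartAt (IT E) v).symm)) (extChartAt (IT E) v v) w (0, u.1) := by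
  have h := (hasFDerivAt_fderiv_comp_chart_symm hf v).clm_comp (hasFDerivAt_const
    ((ContinuousLinearMap.inr ℝ E E).comp (ContinuousLinearMap.fst ℝ E E)) (extChartAt (IT E) v v))
  refine (dOneForm_eq (h.congr_of_eventuallyEq ?_) u w).trans ?_
  · filter_upwards [eventually_fst_mem_target v (extChartAt_tangent_self_fst_mem v)] with z hz
    exact inChart_cartanOneForm hf v hz
  · simp

/-! ### The Rayleigh force -/

theorem contract_rayleighForce_eq_applyField (R : TB E Q → ℝ) (Y : VField (IT E) (TB E Q)) :
    contract (IT E) (rayleighForce R) Y = applyField (IT E) (vertEndoField Y) R := rfl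

theorem vertEndoField_completeLift (X : VField 𝓘(ℝ, E) Q) :
    vertEndoField (completeLift X) = verticalLift X :=
  funext fun v => (vertEndo_apply v (completeLift X v)).trans (vlift_apply v (X v.proj)).symm

/-- In coordinates, with `p = (X̂, DX̂ · q̇)`, both sides equal
`D²ℛ(p)(0, w₁) + Dℛ(0, DX̂ · w₁)`. -/
theorem lieDerivOneForm_rayleighForce {X : VField 𝓘(ℝ, E) Q}
    (hX : ContMDiff 𝓘(ℝ, E) (IT E) ∞ (fun q : Q => (⟨q, X q⟩ : TB E Q)))
    {R : TB E Q → ℝ} (hR : ContMDiff (IT E) 𝓘(ℝ, ℝ) ∞ R) (v : TB E Q) (w : E × E) :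
    lieDerivOneForm (IT E) (completeLift X) (rayleighForce R) v w =
      vertEndoAdj (differential (IT E) (applyField (IT E) (completeLift X) R)) v w := by
  unfold lieDerivOneForm
  rw [contract_rayleighForce_eq_applyField, vertEndoField_completeLift]
  refine (congrArg₂ (· + ·) (dOneForm_cartanOneForm hR v (completeLift X v) w)
    (mvfderiv_verticalLift hX hR v w)).trans ?_
  refine Eq.trans ?_ (congrArg (mvfderiv (IT E) (applyField (IT E) (completeLift X) R) v)
    (vertEndo_apply v w)).symm
  refine Eq.trans ?_ (mvfderiv_completeLift_vertical hX hR v w.1).symm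
  -- The terms `D²ℛ(w)(0, X̂)` of `dβ` and of `d(β(X^c))` cancel; the symmetry of `D²ℛ` matches
  -- what remains with the right-hand side.
  rw [isSymmSndFDerivAt_comp_chart_symm hR v (0, w.1), ← completeLift_eq_fieldInChart hX v]
  have : (completeLift X v : E × E).1 = fieldInChart X v.proj (extChartAt (IT E) v v).1 :=
    congrArg Prod.fst (completeLift_eq_fieldInChart hX v)
  rw [← this]
  have hcancel : ∀ a b c : ℝ, a - b + (b + c) = a + c := fun a b c => by ring
  exact hcancel _ _ _

/-! ### Forced Euler–Lagrange fields -/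

/-- The Hessian at `v` of the restriction of `L` to the fibre of `TQ` through `v`. -/
noncomputable def fiberHessian (L : TB E Q → ℝ) (v : TB E Q) : E →L[ℝ] E →L[ℝ] ℝ :=
  fderiv ℝ (fderiv ℝ (fun w : E => L ⟨v.proj, w⟩)) v.snd

theorem fiberHessian_apply {L : TB E Q → ℝ} (hL : ContMDiff (IT E) 𝓘(ℝ, ℝ) ∞ L) (v : TB E Q)
    (a b : E) :
    fiberHessian L v a b =
      fderiv ℝ (fderiv ℝ (L ∘ (extChartAt (IT E) v).symm)) (extChartAt (IT E) v v)
        (0, a) (0, b) := by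
  have h0 : (fun w : E => L ⟨v.proj, w⟩) = (L ∘ (extChartAt (IT E) v).symm) ∘
      fun w : E => (extChartAt 𝓘(ℝ, E) v.proj v.proj, w) :=
    funext fun w => congrArg L (extChartAt_tangent_symm_mk v w).symm
  have h1 : fderiv ℝ (fun w : E => L ⟨v.proj, w⟩) = fun w =>
      (fderiv ℝ (L ∘ (extChartAt (IT E) v).symm)
        (extChartAt 𝓘(ℝ, E) v.proj v.proj, w)).comp (ContinuousLinearMap.inr ℝ E E) := by
    funext w
    rw [h0]
    have hd := ((contDiffAt_comp_chart_symm hL v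
      (y := (extChartAt 𝓘(ℝ, E) v.proj v.proj, w)) (mem_extChartAt_target _)).differentiableAt
        (by simp)).hasFDerivAt
    exact (hd.comp w (hasFDerivAt_prodMk_right _ w)).fderiv
  have h2 := hasFDerivAt_fderiv_comp_chart_symm hL v
  rw [extChartAt_tangent_self] at h2 ⊢
  have h3 : HasFDerivAt (fun w : E => (extChartAt 𝓘(ℝ, E) v.proj v.proj, w))
      (ContinuousLinearMap.inr ℝ E E) v.snd := hasFDerivAt_prodMk_right _ _
  have h4 := HasFDerivAt.comp (E := E)
    (f := fun w : E => (extChartAt 𝓘(ℝ, E) v.proj v.proj, w)) v.snd h2 h3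
  have h5 := HasFDerivAt.comp (E := E) v.snd ((ContinuousLinearMap.compL ℝ E (E × E) ℝ).flip
    (ContinuousLinearMap.inr ℝ E E)).hasFDerivAt h4
  rw [fiberHessian, h1]
  exact congr($(h5.fderiv) a b)

/-- In finite dimension a bilinear form with trivial left kernel represents every linear form. -/
theorem exists_of_nondegenerate [FiniteDimensional ℝ E] (B : E →L[ℝ] E →L[ℝ] ℝ)
    (hB : ∀ a, (∀ b, B a b = 0) → a = 0) (g : E →L[ℝ] ℝ) : ∃ a, B a = g := by
  let T : E →ₗ[ℝ] Module.Dual ℝ E := (ContinuousLinearMap.coeLM ℝ).comp B.toLinearMap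
  have hT : Function.Injective T := (injective_iff_map_eq_zero T).2 fun a ha =>
    hB a fun b => congr($ha b)
  obtain ⟨a, ha⟩ := (LinearMap.injective_iff_surjective_of_finrank_eq_finrank
    (Subspace.dual_finrank_eq (K := ℝ) (V := E)).symm).1 hT g.toLinearMap
  exact ⟨a, ContinuousLinearMap.ext fun b => congr($ha b)⟩

/-- The equation `ι_ξ ω_L = dE_L + β` at the point `v`, for the value `u` of `ξ`, says that `u` is
of second order (`u.1 = q̇`) and satisfies the forced Euler–Lagrange equations
`u(∂L/∂q̇^i) = ∂L/∂q^i - ∂ℛ/∂q̇^i`. -/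
theorem forcedEL_at_iff {R L : TB E Q → ℝ}
    (hR : ContMDiff (IT E) 𝓘(ℝ, ℝ) ∞ R)
    (hL : ContMDiff (IT E) 𝓘(ℝ, ℝ) ∞ L) (hreg : IsRegularLagrangian L) (v : TB E Q)
    (u : E × E) :
    (∀ w : TangentSpace (IT E) v, cartanTwoForm L v u w =
      differential (IT E) (energy L) v w + rayleighForce R v w) ↔
    u.1 = (extChartAt (IT E) v v).2 ∧ ∀ a : E,
      fderiv ℝ (fderiv ℝ (L ∘ (extChartAt (IT E) v).symm)) (extChartAt (IT E) v v) u (0, a) =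
      fderiv ℝ (L ∘ (extChartAt (IT E) v).symm) (extChartAt (IT E) v v) (a, 0) -
      fderiv ℝ (R ∘ (extChartAt (IT E) v).symm) (extChartAt (IT E) v v) (0, a) := by
  set ℓ := L ∘ (extChartAt (IT E) v).symm
  set r := R ∘ (extChartAt (IT E) v).symm
  set y := extChartAt (IT E) v v
  -- The equation tested on a single `w`, with the terms in `D²ℓ(w)` collected.
  have key : ∀ w : E × E, (cartanTwoForm L v u w =
      differential (IT E) (energy L) v w + rayleighForce R v w) ↔
      fderiv ℝ (fderiv ℝ ℓ) y w (0, u.1 - y.2) + fderiv ℝ ℓ y (w.1, 0) =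
        fderiv ℝ (fderiv ℝ ℓ) y u (0, w.1) + fderiv ℝ r y (0, w.1) := by
    intro w
    have h1 : cartanTwoForm L v u w =
        -(fderiv ℝ (fderiv ℝ ℓ) y u (0, w.1) - fderiv ℝ (fderiv ℝ ℓ) y w (0, u.1)) :=
      congrArg Neg.neg (dOneForm_cartanOneForm hL v u w)
    have h2 : rayleighForce R v w = fderiv ℝ r y (0, w.1) :=
      (congrArg (mvfderiv (IT E) R v) (vertEndo_apply v w)).trans (mvfderiv_eq_fderiv_chart hR v _)
    have h3 : differential (IT E) (energy L) v w =
      fderiv ℝ (fderiv ℝ ℓ) y w (0, y.2) - fderiv ℝ ℓ y (w.1, 0) := mvfderiv_energy hL v w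
    have h4 : ((0 : E), u.1 - y.2) = (0, u.1) - (0, y.2) := by simp
    rw [h1, h2, h3, h4, map_sub]
    constructor <;> intro h <;> linarith
  have hsymm : IsSymmSndFDerivAt ℝ ℓ y := isSymmSndFDerivAt_comp_chart_symm hL v
  constructor
  · intro h
    -- On vertical `w` only the fibre Hessian survives, so regularity forces `u.1 = q̇`.
    have h1 : u.1 - y.2 = 0 := by
      refine hreg v _ fun b => ?_
      change fiberHessian L v _ b = 0
      rw [fiberHessian_apply hL, hsymm]
      have := (key (0, b)).1 (h _)
      rwa [Prod.mk_zero_zero, map_zero, map_zero, map_zero, add_zero, add_zero] at this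
    refine ⟨sub_eq_zero.1 h1, fun a => ?_⟩
    have := (key (a, 0)).1 (h _)
    rw [h1, Prod.mk_zero_zero, map_zero, zero_add] at this
    exact eq_sub_of_add_eq this.symm
  · rintro ⟨h1, h2⟩ w
    refine (key w).2 ?_
    rw [h2, h1, sub_self, Prod.mk_zero_zero, map_zero, zero_add, sub_add_cancel]

theorem existsUnique_isForcedELField [FiniteDimensional ℝ E] {R L : TB E Q → ℝ}
    (hR : ContMDiff (IT E) 𝓘(ℝ, ℝ) ∞ R)
    (hL : ContMDiff (IT E) 𝓘(ℝ, ℝ) ∞ L) (hreg : IsRegularLagrangian L) :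
    ∃! ξ : VField (IT E) (TB E Q), IsForcedELField L (rayleighForce R) ξ := by
  have hpt : ∀ v : TB E Q, ∃! u : E × E, ∀ w : TangentSpace (IT E) v, cartanTwoForm L v u w =
      differential (IT E) (energy L) v w + rayleighForce R v w := by
    intro v
    simp only [forcedEL_at_iff hR hL hreg v]
    set ℓ := L ∘ (extChartAt (IT E) v).symm
    set r := R ∘ (extChartAt (IT E) v).symm
    set y := extChartAt (IT E) v v
    have hsplit : ∀ c a : E, fderiv ℝ (fderiv ℝ ℓ) y (y.2, c) (0, a) =
      fderiv ℝ (fderiv ℝ ℓ) y (y.2, 0) (0, a) + fiberHessian L v c a := by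
      intro c a
      have : (y.2, c) = (y.2, (0 : E)) + (0, c) := by simp
      rw [this, map_add, fiberHessian_apply hL]
      rfl
    -- With `u.1 = q̇` fixed, the Euler–Lagrange equations are linear in the acceleration `c`, with
    -- matrix the fibre Hessian.
    obtain ⟨c, hc⟩ := exists_of_nondegenerate (fiberHessian L v) (hreg v)
      ((fderiv ℝ ℓ y).comp (ContinuousLinearMap.inl ℝ E E) -
        (fderiv ℝ r y).comp (ContinuousLinearMap.inr ℝ E E) -
        (fderiv ℝ (fderiv ℝ ℓ) y (y.2, 0)).comp (ContinuousLinearMap.inr ℝ E E))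
    refine ⟨(y.2, c), ⟨rfl, fun a => ?_⟩, ?_⟩
    · rw [hsplit, hc]
      simp
    · rintro ⟨u1, u2⟩ ⟨rfl, h2⟩
      refine Prod.ext rfl (sub_eq_zero.1 (hreg v _ fun b => ?_))
      change fiberHessian L v (u2 - c) b = 0
      have := h2 b
      rw [hsplit] at this
      rw [map_sub, hc]
      change fiberHessian L v u2 b - (fderiv ℝ ℓ y (b, 0) - fderiv ℝ r y (0, b) -
        fderiv ℝ (fderiv ℝ ℓ) y (y.2, 0) (0, b)) = 0
      linarith
  choose ξ h1 h2 using hpt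
  exact ⟨ξ, h1, fun η hη => funext fun v => h2 v (η v) (hη v)⟩

/-- The Noether identity `ξ(X^v(L)) = X^c(L) - X^v(ℛ)`, a combination of the forced
Euler–Lagrange equations along `X̂` with the second-order condition. -/
theorem applyField_verticalLift_eq_sub {R L : TB E Q → ℝ}
    (hR : ContMDiff (IT E) 𝓘(ℝ, ℝ) ∞ R)
    (hL : ContMDiff (IT E) 𝓘(ℝ, ℝ) ∞ L) (hreg : IsRegularLagrangian L)
    {ξ : VField (IT E) (TB E Q)} (hξ : IsForcedELField L (rayleighForce R) ξ)
    {X : VField 𝓘(ℝ, E) Q}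
    (hX : ContMDiff 𝓘(ℝ, E) (IT E) ∞ (fun q : Q => (⟨q, X q⟩ : TB E Q))) (v : TB E Q) :
    applyField (IT E) ξ (applyField (IT E) (verticalLift X) L) v =
      applyField (IT E) (completeLift X) L v - applyField (IT E) (verticalLift X) R v := by
  obtain ⟨h1, h2⟩ := (forcedEL_at_iff hR hL hreg v (ξ v)).1 (hξ v)
  set ℓ := L ∘ (extChartAt (IT E) v).symm
  set r := R ∘ (extChartAt (IT E) v).symm
  set y := extChartAt (IT E) v v
  have h3 := mvfderiv_verticalLift hX hL v (ξ v)
  have h4 : applyField (IT E) (completeLift X) L v = fderiv ℝ ℓ y _ :=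
    (mvfderiv_eq_fderiv_chart hL v (completeLift X v)).trans
      (congrArg (fderiv ℝ ℓ y) (completeLift_eq_fieldInChart hX v))
  have h5 : applyField (IT E) (verticalLift X) R v =
      fderiv ℝ r y (0, fieldInChart X v.proj y.1) := by
    refine (mvfderiv_eq_fderiv_chart hR v (verticalLift X v)).trans (congrArg (fderiv ℝ r y) ?_)
    exact (vlift_apply v _).trans
      (congrArg (Prod.mk (0 : E)) (congrArg Prod.fst (completeLift_eq_fieldInChart hX v)))
  have h6 : (fieldInChart X v.proj y.1, fderiv ℝ (fieldInChart X v.proj) y.1 y.2) =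
      (fieldInChart X v.proj y.1, (0 : E)) + (0, fderiv ℝ (fieldInChart X v.proj) y.1 y.2) := by
    simp
  refine h3.trans ?_
  rw [h4, h5, h2, h6, map_add, ← h1]
  exact sub_add_eq_add_sub _ _ _

end TangentBundleCharts

end ForcedLagrangian

theorem mainTheorem5
    {E : Type*} [NormedAddCommGroup E] [NormedSpace ℝ E] [FiniteDimensional ℝ E]
    {Q : Type*} [TopologicalSpace Q] [ChartedSpace E Q] [IsManifold 𝓘(ℝ, E) ∞ Q]
    (R : TB E Q → ℝ) (hR : ContMDiff (IT E) 𝓘(ℝ, ℝ) ∞ R) :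
    -- the lemma on the force `S^*(dR)`
    (∀ X : VField 𝓘(ℝ, E) Q,
        ContMDiff 𝓘(ℝ, E) (IT E) ∞ (fun q : Q => (⟨q, X q⟩ : TB E Q)) →
        contract (IT E) (rayleighForce R) (completeLift X) =
            applyField (IT E) (verticalLift X) R ∧
        ∀ (v : TB E Q) (w : TangentSpace (IT E) v),
          lieDerivOneForm (IT E) (completeLift X) (rayleighForce R) v w =
            vertEndoAdj (differential (IT E) (applyField (IT E) (completeLift X) R)) v w) ∧
    (∀ Y : VField (IT E) (TB E Q),
        contract (IT E) (rayleighForce R) Y = applyField (IT E) (vertEndoField Y) R) ∧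
    -- the Noether theorem for the forced system `(L, S^*(dR))`
    ∀ L : TB E Q → ℝ, ContMDiff (IT E) 𝓘(ℝ, ℝ) ∞ L → IsRegularLagrangian L →
      (∃! ξ : VField (IT E) (TB E Q), IsForcedELField L (rayleighForce R) ξ) ∧
      ∀ ξ : VField (IT E) (TB E Q), IsForcedELField L (rayleighForce R) ξ →
        ∀ X : VField 𝓘(ℝ, E) Q,
          ContMDiff 𝓘(ℝ, E) (IT E) ∞ (fun q : Q => (⟨q, X q⟩ : TB E Q)) →
          (applyField (IT E) (completeLift X) L = applyField (IT E) (verticalLift X) R ↔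
            IsConstantOfMotion ξ (applyField (IT E) (verticalLift X) L)) := by
  refine ⟨fun X hX => ⟨?_, lieDerivOneForm_rayleighForce hX hR⟩,
    contract_rayleighForce_eq_applyField R,
    fun L hL hreg => ⟨existsUnique_isForcedELField hR hL hreg, fun ξ hξ X hX => ?_⟩⟩
  · rw [contract_rayleighForce_eq_applyField, vertEndoField_completeLift]
  · rw [funext_iff]
    refine forall_congr' fun v => ?_
    rw [applyField_verticalLift_eq_sub hR hL hreg hξ hX v, sub_eq_zero]
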